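/- Let $\gamma$ denote Euler's constant, put $A = \ln(2\pi) + \gamma$, and for real $z$ let $$\Lambda(z) = \lim_{n\to\infty}\left(\sum_{j=1}^{n} \frac{j}{j^2+z^2} - \ln n\right).$$ Assume $0 < a < \ln 2$ and let $c = 1 - e^{-a}$. Then $$\int_0^\infty e^{-at}\ln\Gamma(t)\,dt = -\frac{\gamma+\ln a}{a\,c\,e^{a}} + \frac{A(a-c)}{a^2 c} - \frac{1}{2a}\,\Lambda\!\left(\frac{a}{2\pi}\right) + 2\sum_{j=1}^{\infty}\frac{\ln j}{a^2+4\pi^2 j^2},$$ where the integral converges absolutely, the limit defining $\Lambda(a/2\pi)$ exists, and the series converges. -/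

import Mathlib

open Filter Topology MeasureTheory

/-- The partial expressions `∑_{j=1}^n j / (j² + z²) - ln n`. -/
noncomputable def eulerLambdaSeq (z : ℝ) (n : ℕ) : ℝ :=
  ∑ j ∈ Finset.Icc 1 n, (j : ℝ) / ((j : ℝ) ^ 2 + z ^ 2) - Real.log n

/-- `Λ(z) = lim_{n → ∞} (∑_{j=1}^n j / (j² + z²) - ln n)`, a generalization of Euler's constant. -/
noncomputable def eulerLambda (z : ℝ) : ℝ :=
  limUnder atTop (eulerLambdaSeq z)

/-! The functional equation $\ln\Gamma(t+1)=\ln\Gamma(t)+\ln t$ turns the half-line integral $L$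
into the unit-interval integral $I=\int_0^1 e^{-at}\ln\Gamma(t)\,dt$: shifting by 1 gives
$e^a(L-I)=L+\int_0^\infty e^{-at}\ln t\,dt$, and the last integral is $-(\gamma+\ln a)/a$
(`integral_exp_neg_mul_log_Gamma`).

$I$ is then computed by Parseval on $[0,1]$, pairing $\ln\Gamma$ with $e^{-at}$. The $k$-th Fourier
coefficient of $\ln\Gamma$ is $(\gamma+\ln s)/s$ with $s=2\pi i k$
(`integral_cexp_two_pi_mul_log_Gamma`), which is minus the Laplace transform of $\ln$ continued to
the imaginary axis. Its mean is $\tfrac12\ln(2\pi)$ (`integral_log_Gamma_zero_one`).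

The Parseval sum splits into three series with denominator $a^2+4\pi^2k^2$. Numerator $1/k$ gives
$\gamma-\Lambda(a/2\pi)$, numerator $1$ has a closed form by Parseval for $e^{-at}$ with itself, and
numerator $\ln k$ is the series of the theorem. -/

/-! ### Laplace transform of the logarithm on the right half-plane. -/

/-- Differentiating a Mellin transform in $s$ inserts a factor $\ln t$; the transform of $e^{-rt}$
is $r^{-s}\Gamma(s)$. -/
theorem mellin_log_mul_exp_neg {r : ℝ} (hr : 0 < r) {s : ℂ} (hs : 0 < s.re) :
    MellinConvergent (fun t : ℝ => Real.log t • Complex.exp (-(r * t))) s ∧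
    HasDerivAt (fun s : ℂ => (1 / r : ℂ) ^ s * Complex.Gamma s)
      (mellin (fun t : ℝ => Real.log t • Complex.exp (-(r * t))) s) s := by
  have hcont : Continuous (fun t : ℝ => Complex.exp (-(r * t))) := by fun_prop
  have h := mellin_hasDerivAt_of_isBigO_rpow (a := s.re + 1) (b := 0)
    (f := fun t : ℝ => Complex.exp (-(r * t))) (s := s)
    (hcont.locallyIntegrable.locallyIntegrableOn _) ?_ (by linarith) ?_ hs
  · refine ⟨h.1, h.2.congr_of_eventuallyEq ?_⟩
    filter_upwards [(isOpen_lt continuous_const Complex.continuous_re).mem_nhds hs] with z hz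
    rw [mellin, ← Complex.integral_cpow_mul_exp_neg_mul_Ioi hz hr]
    simp
  · have h1 := (isLittleO_exp_neg_mul_rpow_atTop hr (-(s.re + 1))).isBigO
    refine (Asymptotics.isBigO_norm_left).mp (h1.norm_left.congr_left fun t => ?_)
    simp [Complex.norm_exp]
  · refine Asymptotics.IsBigO.of_bound 1 ?_
    filter_upwards [self_mem_nhdsWithin] with t ht
    have : 0 < t := ht
    simp [Complex.norm_exp]
    positivity

theorem integrableOn_pow_mul_exp_neg_mul_log (n : ℕ) {r : ℝ} (hr : 0 < r) :
    IntegrableOn (fun t : ℝ => t ^ n * Real.exp (-(r * t)) * Real.log t) (Set.Ioi 0) := by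
  have h := (mellin_log_mul_exp_neg hr (s := n + 1) (by simp; positivity)).1
  rw [MellinConvergent] at h
  refine (h.re).congr (ae_of_all _ fun t => ?_)
  have : (t : ℂ) ^ ((n : ℂ) + 1 - 1) • Real.log t • Complex.exp (-(r * t)) =
      ((t ^ n * Real.exp (-(r * t)) * Real.log t : ℝ) : ℂ) := by
    simp only [add_sub_cancel_right, Complex.cpow_natCast, smul_eq_mul, Complex.real_smul]
    push_cast
    ring
  simp only [this]
  exact Complex.ofReal_re _

theorem integral_exp_neg_mul_log {r : ℝ} (hr : 0 < r) :
    ∫ t in Set.Ioi (0 : ℝ), Real.exp (-(r * t)) * Real.log t =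
      -((Real.eulerMascheroniConstant + Real.log r) / r) := by
  -- At $s=1$ the Mellin kernel $t^{s-1}$ disappears, and $\Gamma'(1)=-\gamma$.
  have h := (mellin_log_mul_exp_neg hr (s := 1) (by simp)).2
  have hr' : (1 / r : ℂ) ≠ 0 := by simp [hr.ne']
  have h2 := ((hasDerivAt_id (1 : ℂ)).const_cpow (c := (1 / r : ℂ)) (Or.inl hr')).mul
    Complex.hasDerivAt_Gamma_one
  have h3 := h.unique h2
  have h4 : mellin (fun t : ℝ => Real.log t • Complex.exp (-(r * t))) 1 =
      ((∫ t in Set.Ioi (0 : ℝ), Real.exp (-(r * t)) * Real.log t : ℝ) : ℂ) := by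
    rw [mellin, ← integral_complex_ofReal]
    refine integral_congr_ae (ae_of_all _ fun t => ?_)
    simp
    ring
  have h5 : Complex.log (1 / r : ℂ) = ((-Real.log r : ℝ) : ℂ) := by
    rw [show (1 / r : ℂ) = ((r⁻¹ : ℝ) : ℂ) by simp, ← Complex.ofReal_log (by positivity),
      Real.log_inv]
  rw [h4, h5] at h3
  apply_fun Complex.re at h3
  simp only [Complex.ofReal_re] at h3
  rw [h3]
  simp
  ring

theorem integrableOn_cexp_neg_mul_log {s : ℂ} (hs : 0 < s.re) :
    IntegrableOn (fun t : ℝ => Complex.exp (-(s * t)) * (Real.log t : ℂ)) (Set.Ioi 0) := by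
  refine (integrableOn_pow_mul_exp_neg_mul_log 0 hs).norm.mono'
    (by fun_prop) (ae_of_all _ fun t => ?_)
  simp [Complex.norm_exp]

theorem hasDerivAt_integral_cexp_neg_mul_log {s : ℂ} (hs : 0 < s.re) :
    HasDerivAt (fun s : ℂ => ∫ t in Set.Ioi (0 : ℝ), Complex.exp (-(s * t)) * (Real.log t : ℂ))
      (∫ t in Set.Ioi (0 : ℝ), Complex.exp (-(s * t)) * (-t) * (Real.log t : ℂ)) s := by
  -- Keeping $\Re z>\Re s/2$ makes $t\,e^{-(\Re s/2)t}|\ln t|$ a uniform integrable bound.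
  have hU : {z : ℂ | s.re / 2 < z.re} ∈ 𝓝 s :=
    (isOpen_lt continuous_const Complex.continuous_re).mem_nhds (by simp; linarith)
  refine (hasDerivAt_integral_of_dominated_loc_of_deriv_le
    (F := fun (s : ℂ) (t : ℝ) => Complex.exp (-(s * t)) * (Real.log t : ℂ))
    (F' := fun (s : ℂ) (t : ℝ) => Complex.exp (-(s * t)) * (-t) * (Real.log t : ℂ))
    (bound := fun t : ℝ => ‖t ^ 1 * Real.exp (-(s.re / 2 * t)) * Real.log t‖)
    hU ?_ (integrableOn_cexp_neg_mul_log hs) ?_ ?_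
    (integrableOn_pow_mul_exp_neg_mul_log 1 (half_pos hs)).norm ?_).2
  · exact Eventually.of_forall fun z => by fun_prop
  · fun_prop
  · refine (ae_restrict_iff' measurableSet_Ioi).2 (ae_of_all _ fun t (ht : 0 < t) z hz => ?_)
    simp only [Set.mem_ofPred_eq] at hz
    simp [Complex.norm_exp]
    rw [mul_comm |t|]
    gcongr
  · refine ae_of_all _ fun t z _ => ?_
    have h : HasDerivAt (fun z : ℂ => -(z * t)) (-t : ℂ) z := by
      simpa using ((hasDerivAt_id' z).mul_const (t : ℂ)).fun_neg
    exact h.cexp.mul_const _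

/-- Both sides are analytic on the half-plane and agree on the positive reals, which accumulate at
1. -/
theorem integral_cexp_neg_mul_log {s : ℂ} (hs : 0 < s.re) :
    ∫ t in Set.Ioi (0 : ℝ), Complex.exp (-(s * t)) * (Real.log t : ℂ) =
      -((Real.eulerMascheroniConstant + Complex.log s) / s) := by
  have hopen : IsOpen {z : ℂ | 0 < z.re} := isOpen_lt continuous_const Complex.continuous_re
  have hne : ∀ {z : ℂ}, 0 < z.re → z ≠ 0 := fun h h0 => by simp [h0] at h
  have hF : AnalyticOnNhd ℂ (fun s : ℂ => ∫ t in Set.Ioi (0 : ℝ),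
      Complex.exp (-(s * t)) * (Real.log t : ℂ)) {z | 0 < z.re} :=
    DifferentiableOn.analyticOnNhd (fun z hz =>
      (hasDerivAt_integral_cexp_neg_mul_log hz).differentiableAt.differentiableWithinAt) hopen
  have hG : AnalyticOnNhd ℂ (fun s : ℂ => -((Real.eulerMascheroniConstant + Complex.log s) / s))
      {z | 0 < z.re} := by
    refine DifferentiableOn.analyticOnNhd (fun z hz => DifferentiableAt.differentiableWithinAt ?_)
      hopen
    exact (((differentiableAt_const _).add
      (Complex.differentiableAt_log (Or.inl hz))).div differentiableAt_id (hne hz)).neg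
  refine hF.eqOn_of_preconnected_of_frequently_eq hG
    (convex_halfSpace_re_gt 0).isPreconnected (z₀ := 1) (by simp) ?_ hs
  have hmap : Tendsto (fun x : ℝ => (x : ℂ)) (𝓝[≠] 1) (𝓝[≠] 1) := by
    refine tendsto_nhdsWithin_iff.2 ⟨?_, ?_⟩
    · simpa using (Complex.continuous_ofReal.tendsto 1).mono_left nhdsWithin_le_nhds
    · filter_upwards [self_mem_nhdsWithin] with x hx
      simpa using hx
  refine hmap.frequently (Eventually.frequently ?_)
  have : ∀ᶠ x : ℝ in 𝓝[≠] 1, 0 < x := (lt_mem_nhds one_pos).filter_mono nhdsWithin_le_nhds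
  filter_upwards [this] with x hx
  rw [← Complex.ofReal_log hx.le]
  have h := congrArg (fun x : ℝ => (x : ℂ)) (integral_exp_neg_mul_log hx)
  simp only [← integral_complex_ofReal] at h
  push_cast at h
  exact h

/-! ### Continuation of the Laplace transform to the imaginary axis. -/

/-- Two integrations by parts trade $\ln u$ for $u^{-2}$, so the remaining integral converges
absolutely even when $\Re s=0$. -/
theorem integral_cexp_neg_mul_log_one_to {s : ℂ} (hs : s ≠ 0) {N : ℝ} (hN : 1 ≤ N) :
    ∫ u in (1 : ℝ)..N, Complex.exp (-(s * u)) * (Real.log u : ℂ) =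
      Complex.exp (-s) / s ^ 2
        - Complex.exp (-(s * N)) * (Real.log N / s + 1 / (s ^ 2 * N))
        - 1 / s ^ 2 * ∫ u in (1 : ℝ)..N, Complex.exp (-(s * u)) / (u : ℂ) ^ 2 := by
  have hpos : ∀ u ∈ Set.uIcc 1 N, (0 : ℝ) < u := fun u hu => by
    rw [Set.uIcc_of_le hN] at hu
    linarith [hu.1]
  have hne : ∀ u ∈ Set.uIcc 1 N, (u : ℂ) ≠ 0 := fun u hu => by
    exact_mod_cast (hpos u hu).ne'
  have hlog : ContinuousOn (fun u : ℝ => (Real.log u : ℂ)) (Set.uIcc 1 N) :=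
    Complex.continuous_ofReal.comp_continuousOn
      (Real.continuousOn_log.mono fun u hu => (hpos u hu).ne')
  have hexp : Continuous fun u : ℝ => Complex.exp (-(s * u)) := by fun_prop
  have hi1 : IntervalIntegrable (fun u : ℝ => Complex.exp (-(s * u)) * (Real.log u : ℂ))
      volume 1 N := (hexp.continuousOn.mul hlog).intervalIntegrable
  have hi2 : IntervalIntegrable (fun u : ℝ => 1 / s ^ 2 * (Complex.exp (-(s * u)) / (u : ℂ) ^ 2))
      volume 1 N := by
    refine ContinuousOn.intervalIntegrable (continuousOn_const.mul (hexp.continuousOn.div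
      (by fun_prop) fun u hu => pow_ne_zero 2 (hne u hu)))
  have key := intervalIntegral.integral_eq_sub_of_hasDerivAt
    (f := fun u : ℝ => -(Complex.exp (-(s * u)) * (Real.log u / s + 1 / (s ^ 2 * u))))
    (f' := fun u : ℝ => Complex.exp (-(s * u)) * (Real.log u : ℂ) +
      1 / s ^ 2 * (Complex.exp (-(s * u)) / (u : ℂ) ^ 2))
    (fun u hu => ?_) (hi1.add hi2)
  · rw [intervalIntegral.integral_add hi1 hi2, intervalIntegral.integral_const_mul] at key
    rw [eq_sub_of_add_eq key]
    simp
    ring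
  · have h1 : HasDerivAt (fun u : ℝ => Complex.exp (-(s * u))) (Complex.exp (-(s * u)) * -s) u := by
      have : HasDerivAt (fun u : ℝ => -(s * (u : ℂ))) (-s) u := by
        simpa using ((Complex.ofRealCLM.hasDerivAt (x := u)).const_mul s).fun_neg
      exact this.cexp
    have h2 : HasDerivAt (fun u : ℝ => (Real.log u : ℂ)) ((u⁻¹ : ℝ) : ℂ) u :=
      (Real.hasDerivAt_log (hpos u hu).ne').ofReal_comp
    have h3 : HasDerivAt (fun u : ℝ => (((u⁻¹ : ℝ)) : ℂ)) ((-(u ^ 2)⁻¹ : ℝ) : ℂ) u :=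
      (hasDerivAt_inv (hpos u hu).ne').ofReal_comp
    have h4 := (h1.mul ((h2.div_const s).add (h3.const_mul (1 / s ^ 2)))).fun_neg
    have hu0 := hne u hu
    refine (h4.congr_deriv ?_).congr_of_eventuallyEq (Eventually.of_forall fun v => ?_)
    · simp
      field_simp
      ring
    · simp
      ring

theorem integrableOn_inv_sq_Ioi_one : IntegrableOn (fun u : ℝ => (u ^ 2)⁻¹) (Set.Ioi 1) := by
  refine (integrableOn_Ioi_rpow_of_lt (a := -2) (by norm_num) one_pos).congr_fun
    (fun u hu => ?_) measurableSet_Ioi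
  have hu : (1 : ℝ) < u := hu
  simp only [Real.rpow_neg (by linarith : 0 ≤ u)]
  norm_num

theorem norm_cexp_neg_mul_le_one {s : ℂ} (hs : 0 ≤ s.re) {u : ℝ} (hu : 0 ≤ u) :
    ‖Complex.exp (-(s * u))‖ ≤ 1 := by
  rw [Complex.norm_exp]
  simp
  positivity

theorem integrableOn_cexp_neg_mul_div_sq {s : ℂ} (hs : 0 ≤ s.re) :
    IntegrableOn (fun u : ℝ => Complex.exp (-(s * u)) / (u : ℂ) ^ 2) (Set.Ioi 1) := by
  refine integrableOn_inv_sq_Ioi_one.mono' (Measurable.aestronglyMeasurable (by fun_prop))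
    ((ae_restrict_iff' measurableSet_Ioi).2 (ae_of_all _ fun u (hu : 1 < u) => ?_))
  have := norm_cexp_neg_mul_le_one hs (by linarith : 0 ≤ u)
  rw [norm_div, norm_pow, Complex.norm_real, Real.norm_eq_abs, sq_abs, div_eq_mul_inv]
  exact mul_le_of_le_one_left (by positivity) this

theorem integral_cexp_neg_mul_log_split {s : ℂ} (hs : 0 < s.re) :
    -((Real.eulerMascheroniConstant + Complex.log s) / s) =
      (∫ u in Set.Ioc (0 : ℝ) 1, Complex.exp (-(s * u)) * (Real.log u : ℂ))
        + (Complex.exp (-s) / s ^ 2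
        - 1 / s ^ 2 * ∫ u in Set.Ioi (1 : ℝ), Complex.exp (-(s * u)) / (u : ℂ) ^ 2) := by
  have hs0 : s ≠ 0 := fun h => by simp [h] at hs
  have hint := integrableOn_cexp_neg_mul_log hs
  rw [← integral_cexp_neg_mul_log hs, ← Set.Ioc_union_Ioi_eq_Ioi zero_le_one,
    setIntegral_union (Set.Ioc_disjoint_Ioi le_rfl) measurableSet_Ioi
      (hint.mono_set Set.Ioc_subset_Ioi_self) (hint.mono_set (Set.Ioi_subset_Ioi zero_le_one))]
  congr 1
  have t1 := intervalIntegral_tendsto_integral_Ioi 1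
    (hint.mono_set (Set.Ioi_subset_Ioi zero_le_one)) tendsto_id
  refine tendsto_nhds_unique t1 ?_
  have t2 := intervalIntegral_tendsto_integral_Ioi 1
    (integrableOn_cexp_neg_mul_div_sq hs.le) tendsto_id
  have t3 : Tendsto (fun N : ℝ => Complex.exp (-(s * N)) * (Real.log N / s + 1 / (s ^ 2 * N)))
      atTop (𝓝 0) := by
    have e : Tendsto (fun N : ℝ => N * Real.exp (-(s.re * N))) atTop (𝓝 0) := by
      simpa using tendsto_rpow_mul_exp_neg_mul_atTop_nhds_zero 1 s.re hs
    have e2 := e.mul_const (1 / ‖s‖ + 1 / ‖s‖ ^ 2)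
    rw [zero_mul] at e2
    refine squeeze_zero_norm' ?_ e2
    filter_upwards [eventually_ge_atTop 1] with N hN
    rw [norm_mul, Complex.norm_exp, mul_comm N, mul_assoc]
    have h1 : (-(s * N)).re = -(s.re * N) := by simp
    rw [h1]
    refine mul_le_mul_of_nonneg_left ?_ (Real.exp_pos _).le
    refine (norm_add_le _ _).trans ?_
    rw [mul_add]
    have hlog0 : 0 ≤ Real.log N := Real.log_nonneg hN
    have hlog1 : Real.log N ≤ N := (Real.log_le_sub_one_of_pos (by linarith)).trans (by linarith)
    have hn : 0 < ‖s‖ := norm_pos_iff.2 hs0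
    gcongr ?_ + ?_
    · rw [norm_div, Complex.norm_real, Real.norm_of_nonneg hlog0, mul_one_div]
      gcongr
    · rw [norm_div, norm_mul, Complex.norm_real, Real.norm_of_nonneg (by linarith), norm_one,
        norm_pow, ← div_div]
      have : 1 / ‖s‖ ^ 2 / N ≤ 1 / ‖s‖ ^ 2 := div_le_self (by positivity) hN
      have h3 : 1 / ‖s‖ ^ 2 ≤ N * (1 / ‖s‖ ^ 2) := le_mul_of_one_le_left (by positivity) hN
      linarith
  have t4 := ((tendsto_const_nhds (x := Complex.exp (-s) / s ^ 2)).sub t3).sub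
    (t2.const_mul (1 / s ^ 2))
  rw [sub_zero] at t4
  refine t4.congr' ?_
  filter_upwards [eventually_ge_atTop 1] with N hN
  exact (integral_cexp_neg_mul_log_one_to hs0 hN).symm

/-- Limit of the split formula along $\varepsilon+s$, $\varepsilon\to0^+$. Both integrals pass to
the limit by dominated convergence, with bounds $|\ln u|$ on $(0,1]$ and $u^{-2}$ beyond. -/
theorem integral_cexp_neg_mul_log_split_imaginary {y : ℝ} (hy : 0 < y) {s : ℂ}
    (hs : s = y * Complex.I) :
    -((Real.eulerMascheroniConstant + Complex.log s) / s) =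
      (∫ u in Set.Ioc (0 : ℝ) 1, Complex.exp (-(s * u)) * (Real.log u : ℂ))
        + (Complex.exp (-s) / s ^ 2
        - 1 / s ^ 2 * ∫ u in Set.Ioi (1 : ℝ), Complex.exp (-(s * u)) / (u : ℂ) ^ 2) := by
  have hs0 : s ≠ 0 := by simp [hs, hy.ne']
  have hslit : s ∈ Complex.slitPlane := by
    right
    simp [hs, hy.ne']
  have hp : Tendsto (fun ε : ℝ => (ε : ℂ) + s) (𝓝[>] 0) (𝓝 s) := by
    have : Continuous (fun ε : ℝ => (ε : ℂ) + s) := by fun_prop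
    simpa using (this.tendsto 0).mono_left nhdsWithin_le_nhds
  have hre : ∀ᶠ ε : ℝ in 𝓝[>] 0, 0 < ((ε : ℂ) + s).re := by
    filter_upwards [self_mem_nhdsWithin] with ε hε
    simpa [hs] using hε
  have t0 : Tendsto (fun z : ℂ => -((Real.eulerMascheroniConstant + Complex.log z) / z)) (𝓝 s)
      (𝓝 (-((Real.eulerMascheroniConstant + Complex.log s) / s))) :=
    ((tendsto_const_nhds.add (continuousAt_clog hslit)).div tendsto_id hs0).neg
  have t1 : Tendsto (fun ε : ℝ => ∫ u in Set.Ioc (0 : ℝ) 1,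
      Complex.exp (-((ε + s) * u)) * (Real.log u : ℂ)) (𝓝[>] 0)
      (𝓝 (∫ u in Set.Ioc (0 : ℝ) 1, Complex.exp (-(s * u)) * (Real.log u : ℂ))) := by
    refine tendsto_integral_filter_of_dominated_convergence (fun u => ‖Real.log u‖)
      (Eventually.of_forall fun ε => by fun_prop) ?_ ?_ ?_
    · filter_upwards [hre] with ε hε
      refine (ae_restrict_iff' measurableSet_Ioc).2 (ae_of_all _ fun u hu => ?_)
      rw [norm_mul, Complex.norm_real]
      exact mul_le_of_le_one_left (norm_nonneg _) (norm_cexp_neg_mul_le_one hε.le hu.1.le)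
    · exact ((intervalIntegrable_iff_integrableOn_Ioc_of_le zero_le_one).1
        intervalIntegral.intervalIntegrable_log').norm
    · refine ae_of_all _ fun u => ?_
      exact ((hp.mul_const (u : ℂ)).neg.cexp).mul_const _
  have t2 : Tendsto (fun ε : ℝ => ∫ u in Set.Ioi (1 : ℝ),
      Complex.exp (-((ε + s) * u)) / (u : ℂ) ^ 2) (𝓝[>] 0)
      (𝓝 (∫ u in Set.Ioi (1 : ℝ), Complex.exp (-(s * u)) / (u : ℂ) ^ 2)) := by
    refine tendsto_integral_filter_of_dominated_convergence (fun u => (u ^ 2)⁻¹)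
      (Eventually.of_forall fun ε => Measurable.aestronglyMeasurable (by fun_prop)) ?_ integrableOn_inv_sq_Ioi_one ?_
    · filter_upwards [hre] with ε hε
      refine (ae_restrict_iff' measurableSet_Ioi).2 (ae_of_all _ fun u (hu : 1 < u) => ?_)
      rw [norm_div, norm_pow, Complex.norm_real, Real.norm_eq_abs, sq_abs, div_eq_mul_inv]
      exact mul_le_of_le_one_left (by positivity)
        (norm_cexp_neg_mul_le_one hε.le (by linarith))
    · refine ae_of_all _ fun u => ?_
      exact ((hp.mul_const (u : ℂ)).neg.cexp).div_const _
  have t3 : Tendsto (fun z : ℂ => Complex.exp (-z) / z ^ 2) (𝓝 s)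
      (𝓝 (Complex.exp (-s) / s ^ 2)) :=
    tendsto_id.neg.cexp.div (tendsto_id.pow 2) (pow_ne_zero 2 hs0)
  have t4 : Tendsto (fun z : ℂ => 1 / z ^ 2) (𝓝 s) (𝓝 (1 / s ^ 2)) :=
    tendsto_const_nhds.div (tendsto_id.pow 2) (pow_ne_zero 2 hs0)
  refine tendsto_nhds_unique (t0.comp hp)
    ((t1.add ((t3.comp hp).sub ((t4.comp hp).mul t2))).congr' ?_)
  filter_upwards [hre] with ε hε
  exact (integral_cexp_neg_mul_log_split hε).symm

theorem intervalIntegrable_cexp_neg_mul_log (s : ℂ) (a b : ℝ) :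
    IntervalIntegrable (fun u : ℝ => Complex.exp (-(s * u)) * (Real.log u : ℂ)) volume a b := by
  have h : IntervalIntegrable (fun u : ℝ => (Real.log u : ℂ)) volume a b :=
    ⟨intervalIntegral.intervalIntegrable_log'.1.ofReal,
      intervalIntegral.intervalIntegrable_log'.2.ofReal⟩
  exact h.continuousOn_mul (by fun_prop)

/-- On the imaginary axis the boundary term at $n$ no longer decays. At $s=2\pi i k$ it is exactly
$\ln n/s+1/(s^2n)$, whence the correction by $\ln n/s$. -/
theorem tendsto_integral_cexp_two_pi_mul_log {k : ℕ} (hk : 0 < k) {s : ℂ}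
    (hs : s = ((2 * Real.pi * k : ℝ) : ℂ) * Complex.I) :
    Tendsto (fun n : ℕ => (∫ u in (0 : ℝ)..n, Complex.exp (-(s * u)) * (Real.log u : ℂ)) +
      Real.log n / s) atTop (𝓝 (-((Real.eulerMascheroniConstant + Complex.log s) / s))) := by
  have hy : 0 < 2 * Real.pi * k := by positivity
  have hs0 : s ≠ 0 := by
    rw [hs]
    exact mul_ne_zero (by exact_mod_cast hy.ne') Complex.I_ne_zero
  have hre : s.re = 0 := by simp [hs]
  rw [integral_cexp_neg_mul_log_split_imaginary hy hs]
  have t2 := (intervalIntegral_tendsto_integral_Ioi 1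
    (integrableOn_cexp_neg_mul_div_sq hre.ge) tendsto_id).comp tendsto_natCast_atTop_atTop
      (α := ℕ)
  have t3 : Tendsto (fun n : ℕ => 1 / (s ^ 2 * (n : ℂ))) atTop (𝓝 0) := by
    have := (tendsto_inv_atTop_nhds_zero_nat (𝕜 := ℂ)).const_mul (1 / s ^ 2)
    rw [mul_zero] at this
    refine this.congr fun n => ?_
    rw [one_div, one_div, mul_inv]
  have t4 := ((tendsto_const_nhds (x := Complex.exp (-s) / s ^ 2)).sub t3).sub
    (t2.const_mul (1 / s ^ 2))
  rw [sub_zero] at t4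
  refine (tendsto_const_nhds.add t4).congr' ?_
  filter_upwards [eventually_ge_atTop 1] with n hn
  have hexp : Complex.exp (-(s * (n : ℝ))) = 1 := by
    rw [Complex.exp_eq_one_iff]
    refine ⟨-(k * n), ?_⟩
    rw [hs]
    push_cast
    ring
  have hn1 : (1 : ℝ) ≤ n := by exact_mod_cast hn
  rw [← intervalIntegral.integral_add_adjacent_intervals
    (intervalIntegrable_cexp_neg_mul_log s 0 1) (intervalIntegrable_cexp_neg_mul_log s 1 n),
    integral_cexp_neg_mul_log_one_to hs0 hn1, hexp, intervalIntegral.integral_of_le zero_le_one]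
  simp
  ring

/-! ### Fourier coefficients on the unit interval and polarized Parseval. -/

theorem fourierCoeffOn_zero_one (f : ℝ → ℂ) (n : ℤ) :
    fourierCoeffOn zero_lt_one f n =
      ∫ t in (0 : ℝ)..1, Complex.exp (-(2 * Real.pi * n * Complex.I * t)) * f t := by
  rw [fourierCoeffOn_eq_integral]
  simp only [sub_zero, div_one, one_smul, smul_eq_mul]
  refine intervalIntegral.integral_congr fun t _ => ?_
  simp only [fourier_coe_apply]
  congr 2
  push_cast
  ring

theorem hasSum_fourierCoeffOn_mul {a b : ℝ} {f g : ℝ → ℂ} (hab : a < b)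
    (hf : MemLp f 2 (volume.restrict (Set.Ioc a b)))
    (hg : MemLp g 2 (volume.restrict (Set.Ioc a b))) :
    HasSum (fun n => starRingEnd ℂ (fourierCoeffOn hab g n) * fourierCoeffOn hab f n)
      ((b - a)⁻¹ • ∫ t in a..b, starRingEnd ℂ (g t) * f t) := by
  have := Fact.mk (by linarith : 0 < b - a)
  rw [← add_sub_cancel a b] at hf hg
  have hf' := hf.memLp_liftIoc.haarAddCircle
  have hg' := hg.memLp_liftIoc.haarAddCircle
  have h := fourierBasis.hasSum_inner_mul_inner hg'.toLp hf'.toLp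
  have e1 : ∀ n, starRingEnd ℂ (fourierCoeffOn hab g n) * fourierCoeffOn hab f n =
      inner ℂ hg'.toLp (fourierBasis n) * inner ℂ (fourierBasis n) hf'.toLp := fun n => by
    rw [← fourierBasis.repr_apply_apply, ← inner_conj_symm, ← fourierBasis.repr_apply_apply,
      fourierBasis_repr, fourierBasis_repr, fourierCoeff_congr_ae hf'.coeFn_toLp,
      fourierCoeff_congr_ae hg'.coeFn_toLp, fourierCoeffOn, fourierCoeffOn]
  have e2 : (b - a)⁻¹ • ∫ t in a..b, starRingEnd ℂ (g t) * f t = inner ℂ hg'.toLp hf'.toLp := by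
    rw [L2.inner_def]
    nth_rw 2 [← add_sub_cancel a b]
    rw [← AddCircle.integral_liftIoc_eq_intervalIntegral, ← AddCircle.integral_haarAddCircle]
    refine integral_congr_ae ?_
    filter_upwards [hf'.coeFn_toLp, hg'.coeFn_toLp] with x hx hy
    rw [hx, hy, RCLike.inner_apply]
    exact mul_comm _ _
  simp only [e1]
  rw [e2]
  exact h

/-! ### Square integrability of $\ln\Gamma$ on the unit interval. -/

theorem log_Gamma_add_one {t : ℝ} (ht : 0 < t) :
    Real.log (Real.Gamma (t + 1)) = Real.log (Real.Gamma t) + Real.log t := by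
  rw [Real.Gamma_add_one ht.ne', Real.log_mul ht.ne' (Real.Gamma_pos_of_pos ht).ne', add_comm]

theorem continuousOn_log_Gamma :
    ContinuousOn (fun t => Real.log (Real.Gamma t)) (Set.Ioi 0) := fun t (ht : 0 < t) =>
  ((Real.differentiableAt_Gamma fun m => by
    have : (0 : ℝ) ≤ m := m.cast_nonneg
    linarith).continuousAt.log (Real.Gamma_pos_of_pos ht).ne').continuousWithinAt

theorem memLp_two_log : MemLp Real.log 2 (volume.restrict (Set.Ioc 0 1)) := by
  rw [memLp_two_iff_integrable_sq Real.measurable_log.aestronglyMeasurable]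
  have h : IntegrableOn (fun t : ℝ => 16 * t ^ (-(1 / 2) : ℝ)) (Set.Ioc 0 1) :=
    ((intervalIntegrable_iff_integrableOn_Ioc_of_le zero_le_one).1
      (intervalIntegral.intervalIntegrable_rpow' (by norm_num))).const_mul 16
  refine h.mono' (by fun_prop)
    ((ae_restrict_iff' measurableSet_Ioc).2 (ae_of_all _ fun t ht => ?_))
  -- The exponent $1/4$ gives $|\ln t|\,t^{1/4}<4$, hence $\ln^2 t\le 16\,t^{-1/2}$, which is
  -- integrable at 0.
  have h1 := Real.abs_log_mul_self_rpow_lt t (1 / 4) ht.1 ht.2 (by norm_num)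
  rw [one_div_one_div] at h1
  have hp : 0 < t ^ (1 / 4 : ℝ) := Real.rpow_pos_of_pos ht.1 _
  have hp2 : t ^ (-(1 / 2) : ℝ) = ((t ^ (1 / 4 : ℝ)) ^ 2)⁻¹ := by
    rw [← Real.rpow_natCast, ← Real.rpow_mul ht.1.le, Real.rpow_neg ht.1.le]
    norm_num
  rw [hp2, Real.norm_of_nonneg (sq_nonneg _), ← div_eq_mul_inv, le_div_iff₀ (by positivity),
    ← mul_pow, ← sq_abs]
  nlinarith [abs_nonneg (Real.log t * t ^ (1 / 4 : ℝ))]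

/-- The only singularity is $-\ln t$ at 0, since $\ln\Gamma(t+1)$ is continuous on $[0,1]$. -/
theorem memLp_two_log_Gamma :
    MemLp (fun t => Real.log (Real.Gamma t)) 2 (volume.restrict (Set.Ioc 0 1)) := by
  have h1 : MemLp (fun t : ℝ => Real.log (Real.Gamma (t + 1))) 2
      (volume.restrict (Set.Ioc 0 1)) := by
    have hc : ContinuousOn (fun t : ℝ => Real.log (Real.Gamma (t + 1))) (Set.Icc 0 1) :=
      continuousOn_log_Gamma.comp (by fun_prop) fun t ht => by
        have := ht.1
        simp only [Set.mem_Ioi]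
        linarith
    obtain ⟨C, hC⟩ := isCompact_Icc.exists_bound_of_continuousOn hc
    refine MemLp.of_bound ((hc.mono Set.Ioc_subset_Icc_self).aestronglyMeasurable
      measurableSet_Ioc) C ((ae_restrict_iff' measurableSet_Ioc).2 (ae_of_all _ fun t ht => ?_))
    exact hC t (Set.Ioc_subset_Icc_self ht)
  refine (h1.sub memLp_two_log).ae_eq
    ((ae_restrict_iff' measurableSet_Ioc).2 (ae_of_all _ fun t ht => ?_))
  simp [log_Gamma_add_one ht.1]

theorem integrableOn_log_Gamma_Ioc :
    IntegrableOn (fun t => Real.log (Real.Gamma t)) (Set.Ioc 0 1) :=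
  memLp_two_log_Gamma.integrable one_le_two

theorem intervalIntegrable_cexp_neg_mul_log_Gamma (s : ℂ) :
    IntervalIntegrable (fun u : ℝ => Complex.exp (-(s * u)) * (Real.log (Real.Gamma u) : ℂ))
      volume 0 1 := by
  have h : IntervalIntegrable (fun u : ℝ => (Real.log (Real.Gamma u) : ℂ)) volume 0 1 :=
    (intervalIntegrable_iff_integrableOn_Ioc_of_le zero_le_one).2 integrableOn_log_Gamma_Ioc.ofReal
  exact h.continuousOn_mul (by fun_prop)

/-! ### Fourier coefficients and mean of $\ln\Gamma$. -/

/-- The Bohr–Mollerup convexity bounds put the difference between $0$ and $x(\ln(n+1)-\ln n)$.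
Uniformity in $x$ is what permits the limit under the integral. -/
theorem abs_log_Gamma_sub_logGammaSeq_le {x : ℝ} (hx : 0 < x) (hx1 : x ≤ 1) {n : ℕ} (hn : n ≠ 0) :
    |Real.log (Real.Gamma x) - Real.BohrMollerup.logGammaSeq x n| ≤
      Real.log (n + 1) - Real.log n := by
  have hfeq : ∀ {y : ℝ}, 0 < y → (Real.log ∘ Real.Gamma) (y + 1) =
      (Real.log ∘ Real.Gamma) y + Real.log y := fun hy => log_Gamma_add_one hy
  have h1 := Real.BohrMollerup.le_logGammaSeq Real.convexOn_log_Gamma hfeq hx hx1 n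
  have h2 := Real.BohrMollerup.ge_logGammaSeq Real.convexOn_log_Gamma hfeq hx hn
  simp only [Function.comp_apply, Real.Gamma_one, Real.log_one, zero_add] at h1 h2
  have hn0 : (0 : ℝ) < n := by positivity
  have h3 : 0 ≤ Real.log (n + 1) - Real.log n :=
    sub_nonneg.2 (Real.log_le_log hn0 (by linarith))
  rw [abs_of_nonneg (by linarith)]
  nlinarith

theorem integral_cexp_two_pi_mul {k : ℕ} (hk : 0 < k) {s : ℂ}
    (hs : s = ((2 * Real.pi * k : ℝ) : ℂ) * Complex.I) :
    ∫ u in (0 : ℝ)..1, Complex.exp (-(s * u)) = 0 ∧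
    ∫ u in (0 : ℝ)..1, Complex.exp (-(s * u)) * u = -1 / s := by
  have hy : 0 < 2 * Real.pi * k := by positivity
  have hs0 : s ≠ 0 := by
    rw [hs]
    exact mul_ne_zero (by exact_mod_cast hy.ne') Complex.I_ne_zero
  have hexp : Complex.exp (-s) = 1 := by
    rw [Complex.exp_eq_one_iff]
    refine ⟨-k, ?_⟩
    rw [hs]
    push_cast
    ring
  have hd : ∀ u : ℝ, HasDerivAt (fun u : ℝ => Complex.exp (-(s * u)))
      (Complex.exp (-(s * u)) * -s) u := fun u => by
    have : HasDerivAt (fun u : ℝ => -(s * (u : ℂ))) (-s) u := by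
      simpa using ((Complex.ofRealCLM.hasDerivAt (x := u)).const_mul s).fun_neg
    exact this.cexp
  constructor
  · rw [intervalIntegral.integral_eq_sub_of_hasDerivAt
      (f := fun u : ℝ => Complex.exp (-(s * u)) * (-1 / s)) (fun u _ => ?_)
      (Continuous.intervalIntegrable (by fun_prop) _ _)]
    · simp [hexp]
    · refine ((hd u).mul_const (-1 / s)).congr_deriv ?_
      field_simp
  · rw [intervalIntegral.integral_eq_sub_of_hasDerivAt
      (f := fun u : ℝ => Complex.exp (-(s * u)) * (-u / s - 1 / s ^ 2)) (fun u _ => ?_)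
      (Continuous.intervalIntegrable (by fun_prop) _ _)]
    · simp [hexp]
    · have h2 : HasDerivAt (fun u : ℝ => -(u : ℂ) / s - 1 / s ^ 2) (-1 / s) u := by
        simpa using (((Complex.ofRealCLM.hasDerivAt (x := u)).fun_neg.div_const s).sub_const
          (1 / s ^ 2))
      refine ((hd u).mul h2).congr_deriv ?_
      field_simp
      ring

theorem intervalIntegrable_cexp_neg_mul_log_add_nat (s : ℂ) (m : ℕ) : IntervalIntegrable
    (fun u : ℝ => Complex.exp (-(s * u)) * (Real.log (u + m) : ℂ)) volume 0 1 := by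
  have h : IntervalIntegrable (fun u : ℝ => Real.log (u + m)) volume 0 1 := by
    simpa using (intervalIntegral.intervalIntegrable_log' (a := 0 + m) (b := 1 + m)).comp_add_right
      (m : ℝ)
  have h' : IntervalIntegrable (fun u : ℝ => (Real.log (u + m) : ℂ)) volume 0 1 :=
    ⟨h.1.ofReal, h.2.ofReal⟩
  exact h'.continuousOn_mul (by fun_prop)

theorem intervalIntegrable_cexp_neg_mul_sum_log (s : ℂ) (n : ℕ) : IntervalIntegrable
    (fun u : ℝ => ∑ m ∈ Finset.range n, Complex.exp (-(s * u)) * (Real.log (u + m) : ℂ))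
    volume 0 1 := by
  have h := IntervalIntegrable.sum (Finset.range n)
    fun m _ => intervalIntegrable_cexp_neg_mul_log_add_nat s m
  rwa [Finset.sum_fn] at h

theorem cexp_neg_mul_logGammaSeq (s : ℂ) (n : ℕ) (u : ℝ) :
    Complex.exp (-(s * u)) * (Real.BohrMollerup.logGammaSeq u n : ℂ) =
      (Real.log n * (Complex.exp (-(s * u)) * u) + Real.log n.factorial * Complex.exp (-(s * u))) -
      ∑ m ∈ Finset.range (n + 1), Complex.exp (-(s * u)) * (Real.log (u + m) : ℂ) := by
  rw [Real.BohrMollerup.logGammaSeq, ← Finset.mul_sum]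
  push_cast
  ring

/-- The kernel has period 1, so the integrals of $\ln(u+m)$ for $m=0,\dots,n$ join into one integral
over $[0,n+1]$. The constant $\ln n!$ integrates to 0, and $u\ln n$ gives $-\ln n/s$. -/
theorem integral_cexp_two_pi_mul_logGammaSeq {k : ℕ} (hk : 0 < k) {s : ℂ}
    (hs : s = ((2 * Real.pi * k : ℝ) : ℂ) * Complex.I) (n : ℕ) :
    ∫ u in (0 : ℝ)..1, Complex.exp (-(s * u)) * (Real.BohrMollerup.logGammaSeq u n : ℂ) =
      -(Real.log n / s) -
        ∫ u in (0 : ℝ)..((n + 1 : ℕ) : ℝ), Complex.exp (-(s * u)) * (Real.log u : ℂ) := by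
  obtain ⟨h0, h1⟩ := integral_cexp_two_pi_mul hk hs
  have hshift : ∀ m : ℕ, ∫ u in (0 : ℝ)..1, Complex.exp (-(s * u)) * (Real.log (u + m) : ℂ) =
      ∫ u in (m : ℝ)..((m + 1 : ℕ) : ℝ), Complex.exp (-(s * u)) * (Real.log u : ℂ) := fun m => by
    have h := intervalIntegral.integral_comp_add_right (a := 0) (b := 1)
      (fun u : ℝ => Complex.exp (-(s * u)) * (Real.log u : ℂ)) (m : ℝ)
    rw [zero_add, add_comm (1 : ℝ), ← Nat.cast_add_one] at h
    rw [← h]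
    refine intervalIntegral.integral_congr fun u _ => ?_
    congr 1
    rw [Complex.exp_eq_exp_iff_exists_int]
    refine ⟨k * m, ?_⟩
    rw [hs]
    push_cast
    ring
  have hsum := intervalIntegral.sum_integral_adjacent_intervals
    (f := fun u : ℝ => Complex.exp (-(s * u)) * (Real.log u : ℂ)) (μ := volume)
    (a := fun m : ℕ => (m : ℝ)) (n := n + 1)
    fun m _ => intervalIntegrable_cexp_neg_mul_log s _ _
  rw [Nat.cast_zero] at hsum
  rw [← hsum, Finset.sum_congr rfl fun m _ => (hshift m).symm,
    ← intervalIntegral.integral_finsetSum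
      fun m _ => intervalIntegrable_cexp_neg_mul_log_add_nat s m]
  simp only [cexp_neg_mul_logGammaSeq]
  rw [intervalIntegral.integral_sub (Continuous.intervalIntegrable (by fun_prop) _ _) ?_,
    intervalIntegral.integral_add (Continuous.intervalIntegrable (by fun_prop) _ _)
      (Continuous.intervalIntegrable (by fun_prop) _ _),
    intervalIntegral.integral_const_mul, intervalIntegral.integral_const_mul, h0, h1]
  · ring
  · exact intervalIntegrable_cexp_neg_mul_sum_log s (n + 1)

theorem integral_cexp_two_pi_mul_log_Gamma {k : ℕ} (hk : 0 < k) {s : ℂ}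
    (hs : s = ((2 * Real.pi * k : ℝ) : ℂ) * Complex.I) :
    ∫ u in (0 : ℝ)..1, Complex.exp (-(s * u)) * (Real.log (Real.Gamma u) : ℂ) =
      (Real.eulerMascheroniConstant + Complex.log s) / s := by
  have hre : s.re = 0 := by simp [hs]
  have tlog : Tendsto (fun n : ℕ => Real.log (n + 1) - Real.log n) atTop (𝓝 0) :=
    (Real.tendsto_log_comp_add_sub_log 1).comp tendsto_natCast_atTop_atTop
  have t1 : Tendsto (fun n : ℕ => ∫ u in (0 : ℝ)..1,
      Complex.exp (-(s * u)) * (Real.BohrMollerup.logGammaSeq u n : ℂ)) atTop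
      (𝓝 (∫ u in (0 : ℝ)..1, Complex.exp (-(s * u)) * (Real.log (Real.Gamma u) : ℂ))) := by
    rw [tendsto_iff_norm_sub_tendsto_zero]
    refine squeeze_zero' (Eventually.of_forall fun _ => norm_nonneg _) ?_ tlog
    filter_upwards [eventually_ne_atTop 0] with n hn
    have hseq : IntervalIntegrable (fun u : ℝ => Complex.exp (-(s * u)) *
        (Real.BohrMollerup.logGammaSeq u n : ℂ)) volume 0 1 := by
      simp only [cexp_neg_mul_logGammaSeq]
      exact (Continuous.intervalIntegrable (by fun_prop) _ _).sub
        (intervalIntegrable_cexp_neg_mul_sum_log s (n + 1))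
    rw [← intervalIntegral.integral_sub hseq (intervalIntegrable_cexp_neg_mul_log_Gamma s)]
    refine (intervalIntegral.norm_integral_le_of_norm_le_const
      (C := Real.log (n + 1) - Real.log n) fun u hu => ?_).trans (by simp)
    rw [Set.uIoc_of_le zero_le_one] at hu
    rw [← mul_sub, norm_mul, ← Complex.ofReal_sub, Complex.norm_real, Real.norm_eq_abs,
      abs_sub_comm]
    exact (mul_le_of_le_one_left (abs_nonneg _) (norm_cexp_neg_mul_le_one hre.ge hu.1.le)).trans
      (abs_log_Gamma_sub_logGammaSeq_le hu.1 hu.2 hn)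
  have t2 := ((tendsto_integral_cexp_two_pi_mul_log hk hs).comp (tendsto_add_atTop_nat 1)).neg
  -- The sequence carries $\ln n$ while the integral runs to $n+1$; the mismatch tends to 0.
  have tlog' : Tendsto (fun n : ℕ => ((Real.log (n + 1) - Real.log n : ℝ) : ℂ) / s) atTop (𝓝 0) := by
    simpa using ((Complex.continuous_ofReal.tendsto 0).comp tlog).div_const s
  have t3 := t2.add tlog'
  rw [neg_neg, add_zero] at t3
  refine tendsto_nhds_unique t1 (t3.congr fun n => ?_)
  rw [integral_cexp_two_pi_mul_logGammaSeq hk hs]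
  simp only [Function.comp_apply, Complex.ofReal_sub, Nat.cast_add, Nat.cast_one]
  ring

/-- Averaging with the reflection $u\mapsto 1-u$ replaces $\ln\Gamma$ by $\tfrac12(\ln\pi-\ln\sin\pi
u)$, and $\int_0^1\ln\sin\pi u\,du=-\ln 2$. -/
theorem integral_log_Gamma_zero_one :
    ∫ u in (0 : ℝ)..1, Real.log (Real.Gamma u) = Real.log (2 * Real.pi) / 2 := by
  have hi : IntervalIntegrable (fun u => Real.log (Real.Gamma u)) volume 0 1 :=
    (intervalIntegrable_iff_integrableOn_Ioc_of_le zero_le_one).2 integrableOn_log_Gamma_Ioc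
  have hi' : IntervalIntegrable (fun u => Real.log (Real.Gamma (1 - u))) volume 0 1 := by
    simpa using (hi.comp_sub_left 1).symm
  have h1 : ∫ u in (0 : ℝ)..1, Real.log (Real.Gamma (1 - u)) =
      ∫ u in (0 : ℝ)..1, Real.log (Real.Gamma u) := by
    simpa using intervalIntegral.integral_comp_sub_left (a := 0) (b := 1)
      (fun u => Real.log (Real.Gamma u)) 1
  have h2 : ∫ u in (0 : ℝ)..1, (Real.log (Real.Gamma u) + Real.log (Real.Gamma (1 - u))) =
      ∫ u in (0 : ℝ)..1, (Real.log Real.pi - Real.log (Real.sin (Real.pi * u))) := by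
    refine intervalIntegral.integral_congr_ae ?_
    have hne : ∀ᵐ u : ℝ, u ≠ 1 := by simp [ae_iff, measure_singleton]
    filter_upwards [hne] with u hu1 hu
    rw [Set.uIoc_of_le zero_le_one] at hu
    have hlt : u < 1 := lt_of_le_of_ne hu.2 hu1
    rw [← Real.log_mul (Real.Gamma_pos_of_pos hu.1).ne'
      (Real.Gamma_pos_of_pos (by linarith)).ne', Real.Gamma_mul_Gamma_one_sub,
      Real.log_div Real.pi_ne_zero]
    refine (Real.sin_pos_of_pos_of_lt_pi (mul_pos Real.pi_pos hu.1) ?_).ne'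
    nlinarith [Real.pi_pos]
  have hsin : IntervalIntegrable (fun u => Real.log (Real.sin (Real.pi * u))) volume 0 1 := by
    simpa [Function.comp_def, Real.pi_ne_zero] using
      (intervalIntegrable_log_sin (a := 0) (b := Real.pi)).comp_mul_left (c := Real.pi)
  have h3 : ∫ u in (0 : ℝ)..1, Real.log (Real.sin (Real.pi * u)) = -Real.log 2 := by
    rw [intervalIntegral.integral_comp_mul_left (fun u => Real.log (Real.sin u)) Real.pi_ne_zero,
      mul_zero, mul_one, integral_log_sin_zero_pi, smul_eq_mul]
    field_simp
  rw [intervalIntegral.integral_add hi hi', h1, intervalIntegral.integral_sub (by simp) hsin,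
    h3] at h2
  rw [Real.log_mul two_ne_zero Real.pi_ne_zero]
  simp at h2
  linarith

/-! ### Parseval for real functions, applied to $e^{-at}$ and $\ln\Gamma$. -/

theorem fourierCoeffOn_neg_ofReal {a b : ℝ} (hab : a < b) (f : ℝ → ℝ) (n : ℤ) :
    fourierCoeffOn hab (fun t => (f t : ℂ)) (-n) =
      starRingEnd ℂ (fourierCoeffOn hab (fun t => (f t : ℂ)) n) := by
  rw [fourierCoeffOn_eq_integral, fourierCoeffOn_eq_integral, Complex.real_smul,
    Complex.real_smul, map_mul, Complex.conj_ofReal, intervalIntegral.integral_of_le hab.le,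
    intervalIntegral.integral_of_le hab.le, ← integral_conj]
  congr 2
  ext t
  rw [smul_eq_mul, smul_eq_mul, map_mul, Complex.conj_ofReal, ← fourier_neg]

theorem hasSum_fourierCoeffOn_mul_ofReal {f g : ℝ → ℝ}
    (hf : MemLp f 2 (volume.restrict (Set.Ioc 0 1)))
    (hg : MemLp g 2 (volume.restrict (Set.Ioc 0 1))) :
    HasSum (fun j : ℕ => 2 * (starRingEnd ℂ
        (fourierCoeffOn zero_lt_one (fun t => (g t : ℂ)) ((j + 1 : ℕ) : ℤ)) *
        fourierCoeffOn zero_lt_one (fun t => (f t : ℂ)) ((j + 1 : ℕ) : ℤ)).re)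
      ((∫ t in (0 : ℝ)..1, g t * f t) -
        (∫ t in (0 : ℝ)..1, g t) * ∫ t in (0 : ℝ)..1, f t) := by
  have h := (hasSum_fourierCoeffOn_mul zero_lt_one hf.ofReal hg.ofReal).nat_add_neg
  -- Folding $n$ with $-n$ counts the zero mode twice; dropping the $j=0$ term leaves the total
  -- minus one product of means.
  have h' := Complex.hasSum_re ((hasSum_nat_add_iff' 1).2 h)
  have zero : ∀ u : ℝ → ℝ, fourierCoeffOn zero_lt_one (fun t => (u t : ℂ)) 0 =
      ((∫ t in (0 : ℝ)..1, u t : ℝ) : ℂ) := fun u => by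
    rw [fourierCoeffOn_zero_one, ← intervalIntegral.integral_ofReal]
    simp
  convert h' using 1
  · ext j
    simp only [RCLike.ofReal_eq_complex_ofReal] at *
    rw [fourierCoeffOn_neg_ofReal, fourierCoeffOn_neg_ofReal, ← map_mul, Complex.add_re,
      Complex.conj_re, two_mul]
  · have e : ∫ t in (0 : ℝ)..1, starRingEnd ℂ (g t : ℂ) * (f t : ℂ) =
        ((∫ t in (0 : ℝ)..1, g t * f t : ℝ) : ℂ) := by
      rw [← intervalIntegral.integral_ofReal]
      simp
    simp only [RCLike.ofReal_eq_complex_ofReal] at *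
    simp only [Finset.range_one, Finset.sum_singleton, Nat.cast_zero, neg_zero, zero, e]
    simp

theorem memLp_two_exp_neg_mul (a : ℝ) :
    MemLp (fun t : ℝ => Real.exp (-(a * t))) 2 (volume.restrict (Set.Ioc 0 1)) := by
  have hc : Continuous (fun t : ℝ => Real.exp (-(a * t))) := by fun_prop
  obtain ⟨C, hC⟩ := (isCompact_Icc (a := (0 : ℝ)) (b := 1)).exists_bound_of_continuousOn
    hc.continuousOn
  exact MemLp.of_bound hc.aestronglyMeasurable C
    ((ae_restrict_iff' measurableSet_Ioc).2 (ae_of_all _ fun t ht =>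
      hC t (Set.Ioc_subset_Icc_self ht)))

theorem fourierCoeffOn_exp_neg_mul {a : ℝ} (ha : 0 < a) (n : ℤ) :
    fourierCoeffOn zero_lt_one (fun t : ℝ => (Real.exp (-(a * t)) : ℂ)) n =
      (1 - Real.exp (-a)) / (a + (2 * Real.pi * n : ℝ) * Complex.I) := by
  rw [fourierCoeffOn_zero_one]
  set w : ℂ := a + (2 * Real.pi * n : ℝ) * Complex.I with hw
  have hw0 : w ≠ 0 := fun h => by
    have := congrArg Complex.re h
    simp [hw] at this
    exact ha.ne' this
  have e : ∀ t : ℝ, Complex.exp (-(2 * Real.pi * n * Complex.I * t)) *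
      (Real.exp (-(a * t)) : ℂ) = Complex.exp (-w * t) := fun t => by
    push_cast
    rw [← Complex.exp_add, hw]
    congr 1
    push_cast
    ring
  simp only [e]
  rw [integral_exp_mul_complex (neg_ne_zero.2 hw0)]
  have e1 : Complex.exp (-w * (1 : ℝ)) = (Real.exp (-a) : ℂ) := by
    push_cast
    rw [Complex.exp_eq_exp_iff_exists_int]
    refine ⟨-n, ?_⟩
    rw [hw]
    push_cast
    ring
  rw [e1]
  simp
  field_simp
  ring

theorem fourierCoeffOn_log_Gamma {k : ℕ} (hk : 0 < k) :
    fourierCoeffOn zero_lt_one (fun t : ℝ => (Real.log (Real.Gamma t) : ℂ)) k =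
      (Real.eulerMascheroniConstant + Real.log (2 * Real.pi * k) + Real.pi / 2 * Complex.I) /
        ((2 * Real.pi * k : ℝ) * Complex.I) := by
  have hy : 0 < 2 * Real.pi * k := by positivity
  have hlog : Complex.log ((2 * Real.pi * k : ℝ) * Complex.I) =
      Real.log (2 * Real.pi * k) + Real.pi / 2 * Complex.I := by
    rw [Complex.log_ofReal_mul hy Complex.I_ne_zero, Complex.log_I]
  rw [fourierCoeffOn_zero_one, add_assoc, ← hlog, ← integral_cexp_two_pi_mul_log_Gamma hk rfl]
  refine intervalIntegral.integral_congr fun t _ => ?_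
  push_cast
  congr 3

theorem integral_exp_neg_mul_zero_one {a : ℝ} (ha : 0 < a) :
    ∫ t in (0 : ℝ)..1, Real.exp (-(a * t)) = (1 - Real.exp (-a)) / a := by
  rw [intervalIntegral.integral_eq_sub_of_hasDerivAt
    (f := fun t => -(Real.exp (-(a * t)) / a)) (fun t _ => ?_)
    (Continuous.intervalIntegrable (by fun_prop) _ _)]
  · simp
    field_simp
    ring
  · have : HasDerivAt (fun t : ℝ => -(a * t)) (-a) t := by
      simpa using ((hasDerivAt_id' t).const_mul a).fun_neg
    refine ((this.exp.div_const a).fun_neg).congr_deriv ?_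
    field_simp

/-- Parseval for $e^{-at}$ with itself: $|\hat g(k)|^2=c^2/(a^2+4\pi^2k^2)$ with $c=1-e^{-a}$. -/
theorem hasSum_inv_sq_add_sq {a : ℝ} (ha : 0 < a) :
    HasSum (fun j : ℕ => 1 / (a ^ 2 + 4 * Real.pi ^ 2 * ((j : ℝ) + 1) ^ 2))
      ((2 - (1 - Real.exp (-a))) / (4 * a * (1 - Real.exp (-a))) - 1 / (2 * a ^ 2)) := by
  have hc : 0 < 1 - Real.exp (-a) := by simp [ha]
  have h := hasSum_fourierCoeffOn_mul_ofReal (memLp_two_exp_neg_mul a) (memLp_two_exp_neg_mul a)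
  have e : ∫ t in (0 : ℝ)..1, Real.exp (-(a * t)) * Real.exp (-(a * t)) =
      (1 - Real.exp (-a)) * (1 + Real.exp (-a)) / (2 * a) := by
    have : ∀ t, Real.exp (-(a * t)) * Real.exp (-(a * t)) = Real.exp (-(2 * a * t)) := fun t => by
      rw [← Real.exp_add]
      ring_nf
    simp only [this]
    rw [integral_exp_neg_mul_zero_one (by positivity)]
    have : Real.exp (-(2 * a)) = Real.exp (-a) * Real.exp (-a) := by
      rw [← Real.exp_add]
      ring_nf
    rw [this]
    ring
  rw [e, integral_exp_neg_mul_zero_one ha] at h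
  convert! h.mul_left (1 / (2 * (1 - Real.exp (-a)) ^ 2)) using 1
  · ext j
    rw [fourierCoeffOn_exp_neg_mul ha, mul_comm (starRingEnd ℂ _), Complex.mul_conj,
      Complex.ofReal_re, Complex.normSq_div, ← Complex.ofReal_one, ← Complex.ofReal_sub,
      Complex.normSq_ofReal, Complex.normSq_add_mul_I]
    push_cast
    have : 0 < a ^ 2 + (2 * Real.pi * ((j : ℝ) + 1)) ^ 2 := by positivity
    have : 0 < a ^ 2 + 4 * Real.pi ^ 2 * ((j : ℝ) + 1) ^ 2 := by positivity
    field_simp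
    ring
  · field_simp
    ring

theorem re_conj_div_mul_div (c B p : ℝ) {a y : ℝ} (ha : 0 < a) (hy : 0 < y) :
    (starRingEnd ℂ (c / (a + y * Complex.I)) * ((B + p * Complex.I) / (y * Complex.I))).re =
      c * (a * p + y * B) / (y * (a ^ 2 + y ^ 2)) := by
  have hD : 0 < a ^ 2 + y ^ 2 := by positivity
  have e : starRingEnd ℂ (c / (a + y * Complex.I)) * ((B + p * Complex.I) / (y * Complex.I)) =
      ((c * (a * p + y * B) / (y * (a ^ 2 + y ^ 2)) : ℝ) : ℂ) +
        ((c * (y * p - a * B) / (y * (a ^ 2 + y ^ 2)) : ℝ) : ℂ) * Complex.I := by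
    have hy' : (y : ℂ) ≠ 0 := by exact_mod_cast hy.ne'
    have hD' : (a : ℂ) ^ 2 + (y : ℂ) ^ 2 ≠ 0 := by exact_mod_cast hD.ne'
    have hf : ((a : ℂ) + y * Complex.I) * (a - y * Complex.I) = a ^ 2 + y ^ 2 := by
      linear_combination -(y : ℂ) ^ 2 * Complex.I_sq
    have h2 : (a : ℂ) - y * Complex.I ≠ 0 := right_ne_zero_of_mul (hf ▸ hD')
    rw [map_div₀, map_add, map_mul, Complex.conj_ofReal, Complex.conj_ofReal, Complex.conj_ofReal,
      Complex.conj_I, mul_neg, ← sub_eq_add_neg]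
    push_cast
    rw [← hf]
    have h1 : (a : ℂ) + y * Complex.I ≠ 0 := left_ne_zero_of_mul (hf ▸ hD')
    field_simp
    ring_nf
    simp only [Complex.I_sq]
    ring
  rw [e, Complex.add_re, Complex.ofReal_re, Complex.re_ofReal_mul, Complex.I_re, mul_zero, add_zero]

theorem hasSum_log_Gamma_fourier {a : ℝ} (ha : 0 < a) :
    HasSum (fun j : ℕ => (1 - Real.exp (-a)) * (a / (2 * ((j : ℝ) + 1)) +
        2 * (Real.eulerMascheroniConstant + Real.log (2 * Real.pi) + Real.log ((j : ℝ) + 1))) /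
        (a ^ 2 + 4 * Real.pi ^ 2 * ((j : ℝ) + 1) ^ 2))
      ((∫ t in (0 : ℝ)..1, Real.exp (-(a * t)) * Real.log (Real.Gamma t)) -
        (1 - Real.exp (-a)) / a * (Real.log (2 * Real.pi) / 2)) := by
  have h := hasSum_fourierCoeffOn_mul_ofReal memLp_two_log_Gamma (memLp_two_exp_neg_mul a)
  rw [integral_exp_neg_mul_zero_one ha, integral_log_Gamma_zero_one] at h
  convert! h using 1
  ext j
  have hj : (0 : ℝ) < (j : ℝ) + 1 := by positivity
  rw [fourierCoeffOn_exp_neg_mul ha, fourierCoeffOn_log_Gamma j.succ_pos]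
  have hy : 0 < 2 * Real.pi * ((j : ℝ) + 1) := by positivity
  -- The imaginary part $\pi/2$ of $\ln(2\pi i k)$ produces the $a/(2k)$ term.
  have h := re_conj_div_mul_div (1 - Real.exp (-a))
    (Real.eulerMascheroniConstant + Real.log (2 * Real.pi * ((j : ℝ) + 1))) (Real.pi / 2) ha hy
  push_cast at h ⊢
  rw [h, Real.log_mul (by positivity) hj.ne']
  have hD : 0 < a ^ 2 + (2 * Real.pi * ((j : ℝ) + 1)) ^ 2 := by positivity
  have hD' : 0 < a ^ 2 + 4 * Real.pi ^ 2 * ((j : ℝ) + 1) ^ 2 := by positivity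
  field_simp
  ring

/-! ### Separation of the three series. -/

/-- Since $\frac1j-\frac{j}{j^2+z^2}=\frac{z^2}{j(j^2+z^2)}$, comparison with $H_n-\ln n\to\gamma$
gives both claims. -/
theorem tendsto_eulerLambdaSeq_and_hasSum (z : ℝ) :
    Tendsto (eulerLambdaSeq z) atTop (𝓝 (eulerLambda z)) ∧
    HasSum (fun j : ℕ => z ^ 2 / (((j : ℝ) + 1) * (((j : ℝ) + 1) ^ 2 + z ^ 2)))
      (Real.eulerMascheroniConstant - eulerLambda z) := by
  have hsum : Summable (fun j : ℕ => z ^ 2 / (((j : ℝ) + 1) * (((j : ℝ) + 1) ^ 2 + z ^ 2))) := by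
    have h : Summable (fun j : ℕ => z ^ 2 * (1 / (((j + 1 : ℕ) : ℝ)) ^ 2)) :=
      ((summable_nat_add_iff 1).2 (Real.summable_one_div_nat_pow.2 one_lt_two)).mul_left _
    refine Summable.of_nonneg_of_le (fun j => by positivity) (fun j => ?_) h
    have hj : (0 : ℝ) ≤ j := j.cast_nonneg
    rw [mul_one_div]
    push_cast
    gcongr
    nlinarith [sq_nonneg z, mul_nonneg hj (sq_nonneg z), mul_nonneg hj (sq_nonneg ((j : ℝ) + 1))]
  have ht : Tendsto (eulerLambdaSeq z) atTop (𝓝 (Real.eulerMascheroniConstant -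
      ∑' j : ℕ, z ^ 2 / (((j : ℝ) + 1) * (((j : ℝ) + 1) ^ 2 + z ^ 2)))) := by
    refine (Real.tendsto_harmonic_sub_log.sub hsum.hasSum.tendsto_sum_nat).congr fun n => ?_
    rw [eulerLambdaSeq, harmonic]
    push_cast
    rw [sub_right_comm, ← Finset.sum_sub_distrib, ← Finset.Ico_add_one_right_eq_Icc,
      Finset.sum_Ico_eq_sum_range, Nat.add_sub_cancel]
    congr 1
    refine Finset.sum_congr rfl fun j _ => ?_
    have hj : (0 : ℝ) < (j : ℝ) + 1 := by positivity
    have hD : 0 < ((j : ℝ) + 1) ^ 2 + z ^ 2 := by positivity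
    push_cast
    rw [add_comm (1 : ℝ)]
    field_simp
    ring
  have hl : eulerLambda z = _ := ht.limUnder_eq
  refine ⟨hl ▸ ht, ?_⟩
  rw [hl, sub_sub_cancel]
  exact hsum.hasSum

theorem hasSum_log_div_sq_add_sq {a : ℝ} (ha : 0 < a) :
    HasSum (fun j : ℕ => Real.log ((j : ℝ) + 1) / (a ^ 2 + 4 * Real.pi ^ 2 * ((j : ℝ) + 1) ^ 2))
      (1 / (2 * (1 - Real.exp (-a))) *
        ((∫ t in (0 : ℝ)..1, Real.exp (-(a * t)) * Real.log (Real.Gamma t)) -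
          (1 - Real.exp (-a)) / a * (Real.log (2 * Real.pi) / 2)) -
        1 / (4 * a) * (Real.eulerMascheroniConstant - eulerLambda (a / (2 * Real.pi))) -
        (Real.eulerMascheroniConstant + Real.log (2 * Real.pi)) *
        ((2 - (1 - Real.exp (-a))) / (4 * a * (1 - Real.exp (-a))) - 1 / (2 * a ^ 2))) := by
  have hc : 0 < 1 - Real.exp (-a) := by simp [ha]
  have h := (((hasSum_log_Gamma_fourier ha).mul_left (1 / (2 * (1 - Real.exp (-a))))).sub
    ((tendsto_eulerLambdaSeq_and_hasSum (a / (2 * Real.pi))).2.mul_left (1 / (4 * a)))).sub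
    ((hasSum_inv_sq_add_sq ha).mul_left (Real.eulerMascheroniConstant + Real.log (2 * Real.pi)))
  refine h.congr_fun fun j => ?_
  have hj : (0 : ℝ) < (j : ℝ) + 1 := by positivity
  have hD' : 0 < a ^ 2 + 4 * Real.pi ^ 2 * ((j : ℝ) + 1) ^ 2 := by positivity
  have e : ((j : ℝ) + 1) ^ 2 + (a / (2 * Real.pi)) ^ 2 =
      (a ^ 2 + 4 * Real.pi ^ 2 * ((j : ℝ) + 1) ^ 2) / (4 * Real.pi ^ 2) := by
    field_simp
    ring
  rw [e]
  generalize a ^ 2 + 4 * Real.pi ^ 2 * ((j : ℝ) + 1) ^ 2 = D at *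
  field_simp
  ring

/-! ### Integrability on the half-line and reduction to the unit interval. -/

theorem exists_abs_log_Gamma_add_one_le :
    ∃ C : ℝ, ∀ t : ℝ, 0 ≤ t → |Real.log (Real.Gamma (t + 1))| ≤ C + t ^ 2 := by
  have hc : ContinuousOn (fun t : ℝ => Real.log (Real.Gamma (t + 1))) (Set.Icc 0 1) :=
    continuousOn_log_Gamma.comp (by fun_prop) fun t ht => by
      have := ht.1
      simp only [Set.mem_Ioi]
      linarith
  obtain ⟨C, hC⟩ := isCompact_Icc.exists_bound_of_continuousOn hc
  have key : ∀ n : ℕ, ∀ t : ℝ, 0 ≤ t → t ≤ n + 1 →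
      |Real.log (Real.Gamma (t + 1))| ≤ C + t ^ 2 := by
    intro n
    induction n with
    | zero =>
      intro t ht0 ht1
      have := hC t ⟨ht0, by simpa using ht1⟩
      rw [Real.norm_eq_abs] at this
      nlinarith
    | succ n ih =>
      intro t ht0 ht1
      push_cast at ht1
      by_cases h : t ≤ 1
      · exact ih t ht0 (h.trans (by simp))
      · push Not at h
        have h1 := ih (t - 1) (by linarith) (by linarith)
        rw [sub_add_cancel] at h1
        rw [log_Gamma_add_one (by linarith)]
        have h2 : |Real.log t| ≤ t := by
          rw [abs_of_nonneg (Real.log_nonneg h.le)]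
          linarith [Real.log_le_sub_one_of_pos (by linarith : 0 < t)]
        have h3 := abs_add_le (Real.log (Real.Gamma t)) (Real.log t)
        -- The quadratic bound propagates because $(t-1)^2+t\le t^2$ for $t\ge1$.
        nlinarith
  refine ⟨C, fun t ht => key ⌈t⌉₊ t ht ?_⟩
  linarith [Nat.le_ceil t]

theorem integrableOn_exp_neg_mul_log_Gamma_add_one {a : ℝ} (ha : 0 < a) :
    IntegrableOn (fun t : ℝ => Real.exp (-(a * t)) * Real.log (Real.Gamma (t + 1)))
      (Set.Ioi 0) := by
  obtain ⟨C, hC⟩ := exists_abs_log_Gamma_add_one_le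
  have i0 : IntegrableOn (fun t : ℝ => C * Real.exp (-(a * t))) (Set.Ioi 0) := by
    simpa [IntegrableOn] using (exp_neg_integrableOn_Ioi 0 ha).const_mul C
  have i2 : IntegrableOn (fun t : ℝ => t ^ 2 * Real.exp (-(a * t))) (Set.Ioi 0) := by
    simpa using integrableOn_rpow_mul_exp_neg_mul_rpow (s := 2) (p := 1) (by norm_num) one_pos ha
  have hmeas : AEStronglyMeasurable
      (fun t : ℝ => Real.exp (-(a * t)) * Real.log (Real.Gamma (t + 1)))
      (volume.restrict (Set.Ioi 0)) := by
    refine ContinuousOn.aestronglyMeasurable ?_ measurableSet_Ioi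
    refine ContinuousOn.mul (by fun_prop) (continuousOn_log_Gamma.comp (by fun_prop) ?_)
    intro t (ht : 0 < t)
    simp only [Set.mem_Ioi]
    linarith
  refine (i0.add i2).mono' hmeas
    ((ae_restrict_iff' measurableSet_Ioi).2 (ae_of_all _ fun t (ht : 0 < t) => ?_))
  rw [norm_mul, Real.norm_of_nonneg (Real.exp_pos _).le, Real.norm_eq_abs, Pi.add_apply, ← add_mul,
    mul_comm]
  exact mul_le_mul_of_nonneg_right (hC t ht.le) (Real.exp_pos _).le

theorem integrableOn_exp_neg_mul_log {a : ℝ} (ha : 0 < a) :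
    IntegrableOn (fun t : ℝ => Real.exp (-(a * t)) * Real.log t) (Set.Ioi 0) := by
  simpa using integrableOn_pow_mul_exp_neg_mul_log 0 ha

theorem integrableOn_exp_neg_mul_log_Gamma {a : ℝ} (ha : 0 < a) :
    IntegrableOn (fun t : ℝ => Real.exp (-(a * t)) * Real.log (Real.Gamma t)) (Set.Ioi 0) := by
  refine ((integrableOn_exp_neg_mul_log_Gamma_add_one ha).sub
    (integrableOn_exp_neg_mul_log ha)).congr_fun (fun t (ht : 0 < t) => ?_) measurableSet_Ioi
  simp only [Pi.sub_apply, log_Gamma_add_one ht]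
  ring

theorem integral_exp_neg_mul_log_Gamma {a : ℝ} (ha : 0 < a) :
    ∫ t in Set.Ioi (0 : ℝ), Real.exp (-(a * t)) * Real.log (Real.Gamma t) =
      (∫ t in (0 : ℝ)..1, Real.exp (-(a * t)) * Real.log (Real.Gamma t)) / (1 - Real.exp (-a)) -
      (Real.eulerMascheroniConstant + Real.log a) / (a * (1 - Real.exp (-a)) * Real.exp a) := by
  have hc : 0 < 1 - Real.exp (-a) := by simp [ha]
  have hG := integrableOn_exp_neg_mul_log_Gamma ha
  have h1 : ∫ t in Set.Ioi (0 : ℝ), Real.exp (-(a * t)) * Real.log (Real.Gamma (t + 1)) =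
      (∫ t in Set.Ioi (0 : ℝ), Real.exp (-(a * t)) * Real.log (Real.Gamma t)) +
      ∫ t in Set.Ioi (0 : ℝ), Real.exp (-(a * t)) * Real.log t := by
    rw [← integral_add hG (integrableOn_exp_neg_mul_log ha)]
    refine setIntegral_congr_fun measurableSet_Ioi fun t (ht : 0 < t) => ?_
    simp only [log_Gamma_add_one ht]
    ring
  have h2 : ∫ t in Set.Ioi (0 : ℝ), Real.exp (-(a * t)) * Real.log (Real.Gamma (t + 1)) =
      Real.exp a *
        ∫ t in Set.Ioi (1 : ℝ), Real.exp (-(a * t)) * Real.log (Real.Gamma t) := by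
    have h := (measurePreserving_add_right (volume : Measure ℝ) 1).setIntegral_preimage_emb
      (measurableEmbedding_addRight 1)
      (fun t : ℝ => Real.exp (-(a * t)) * Real.log (Real.Gamma t)) (Set.Ioi 1)
    rw [Set.preimage_add_const_Ioi, sub_self] at h
    rw [← h, ← integral_const_mul]
    refine setIntegral_congr_fun measurableSet_Ioi fun t _ => ?_
    rw [← mul_assoc, ← Real.exp_add]
    ring_nf
  have h3 : ∫ t in Set.Ioi (0 : ℝ), Real.exp (-(a * t)) * Real.log (Real.Gamma t) =
      (∫ t in (0 : ℝ)..1, Real.exp (-(a * t)) * Real.log (Real.Gamma t)) +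
      ∫ t in Set.Ioi (1 : ℝ), Real.exp (-(a * t)) * Real.log (Real.Gamma t) := by
    rw [intervalIntegral.integral_of_le zero_le_one, ← setIntegral_union
      (Set.Ioc_disjoint_Ioi le_rfl) measurableSet_Ioi (hG.mono_set Set.Ioc_subset_Ioi_self)
      (hG.mono_set (Set.Ioi_subset_Ioi zero_le_one)), Set.Ioc_union_Ioi_eq_Ioi zero_le_one]
  rw [integral_exp_neg_mul_log ha, h2] at h1
  rw [eq_sub_of_add_eq' h3.symm] at h1
  have hE : Real.exp a * (1 - Real.exp (-a)) = Real.exp a - 1 := by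
    rw [mul_sub, ← Real.exp_add, add_neg_cancel, Real.exp_zero, mul_one]
  generalize ∫ t in Set.Ioi (0 : ℝ), Real.exp (-(a * t)) * Real.log (Real.Gamma t) = L at *
  generalize ∫ t in (0 : ℝ)..1, Real.exp (-(a * t)) * Real.log (Real.Gamma t) = I at *
  have he := Real.exp_pos a
  field_simp at h1 ⊢
  -- The shift identity is linear in $L$ with coefficient $e^a-1=e^a(1-e^{-a})$.
  linear_combination h1 + a * L * hE

theorem mainTheorem6 (a c A : ℝ) (ha : 0 < a) (ha2 : a < Real.log 2)
    (hc : c = 1 - Real.exp (-a))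
    (hA : A = Real.log (2 * Real.pi) + Real.eulerMascheroniConstant) :
    IntegrableOn (fun t : ℝ => Real.exp (-(a * t)) * Real.log (Real.Gamma t)) (Set.Ioi 0) ∧
    Tendsto (eulerLambdaSeq (a / (2 * Real.pi))) atTop
      (𝓝 (eulerLambda (a / (2 * Real.pi)))) ∧
    Summable (fun j : ℕ =>
      Real.log ((j : ℝ) + 1) / (a ^ 2 + 4 * Real.pi ^ 2 * ((j : ℝ) + 1) ^ 2)) ∧
    ∫ t in Set.Ioi (0 : ℝ), Real.exp (-(a * t)) * Real.log (Real.Gamma t) =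
      -((Real.eulerMascheroniConstant + Real.log a) / (a * c * Real.exp a))
        + A * (a - c) / (a ^ 2 * c)
        - 1 / (2 * a) * eulerLambda (a / (2 * Real.pi))
        + 2 * ∑' j : ℕ,
            Real.log ((j : ℝ) + 1) / (a ^ 2 + 4 * Real.pi ^ 2 * ((j : ℝ) + 1) ^ 2) := by
  have h := hasSum_log_div_sq_add_sq ha
  refine ⟨integrableOn_exp_neg_mul_log_Gamma ha, (tendsto_eulerLambdaSeq_and_hasSum _).1,
    h.summable, ?_⟩
  have hc0 : 0 < c := by simp [hc, ha]
  rw [h.tsum_eq, integral_exp_neg_mul_log_Gamma ha, ← hc, hA]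
  have he := Real.exp_pos a
  field_simp
  ring
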